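/- Let $G$ be a plane graph (a finite simple graph embedded in the plane) with minimum degree five. For $\kappa_1, \dots, \kappa_5 \in \mathbb{N} \cup \{\infty\}$, a $\langle \kappa_1, \kappa_2, \kappa_3, \kappa_4, \kappa_5 \rangle$-star in $G$ consists of a vertex of degree five (the center) together with its five neighbors, where the neighbors, listed in the cyclic order in which they appear around the center (clockwise or counterclockwise, starting from any one of them), have degrees in $G$ at most $\kappa_1, \kappa_2, \kappa_3, \kappa_4, \kappa_5$, respectively. Then $G$ contains at least one of the following 40 types of $5$-stars: $\langle 5, 5, 5, 7, 17 \rangle$, $\langle 7, 5, 5, 7, 11 \rangle$, $\langle 7, 5, 5, 8, 9 \rangle$, $\langle 7, 5, 5, 9, 8 \rangle$, $\langle 7, 5, 5, 11, 7 \rangle$, $\langle 5, 5, 5, 8, 11 \rangle$, $\langle 8, 5, 5, 9, 7 \rangle$, $\langle 8, 5, 5, 11, 6 \rangle$, $\langle 6, 6, 6, 6, 11 \rangle$, $\langle 6, 6, 6, 7, 9 \rangle$, $\langle 6, 6, 7, 6, 9 \rangle$, $\langle 6, 6, 7, 7, 7 \rangle$, $\langle 6, 7, 6, 7, 7 \rangle$,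 $\langle 5, 6, 6, 8, 9 \rangle$, $\langle 5, 6, 8, 6, 9 \rangle$, $\langle 5, 6, 7, 7, 9 \rangle$, $\langle 5, 6, 6, 7, 11 \rangle$, $\langle 5, 6, 7, 6, 11 \rangle$, $\langle 5, 7, 6, 7, 9 \rangle$, $\langle 5, 7, 7, 6, 9 \rangle$, $\langle 5, 6, 6, 6, 17 \rangle$, $\langle 5, 7, 6, 6, 11 \rangle$, $\langle 5, 8, 6, 6, 10 \rangle$, $\langle 5, 9, 6, 6, 9 \rangle$, $\langle 5, 5, 9, 6, 9 \rangle$, $\langle 5, 6, 6, 5, \infty \rangle$, $\langle 5, 6, 7, 5, 23 \rangle$, $\langle 5, 6, 8, 5, 15 \rangle$, $\langle 5, 6, 9, 5, 14 \rangle$, $\langle 5, 9, 5, 6, 10 \rangle$, $\langle 5, 8, 5, 6, 11 \rangle$, $\langle 5, 7, 5, 6, 17 \rangle$, $\langle 5, 7, 7, 5, 11 \rangle$, $\langle 5, 7, 8, 5, 9 \rangle$, $\langle 5, 8, 5, 7, 9 \rangle$, $\langle 5, 7, 5, 7, 11 \rangle$, $\langle 5, 7, 5, 8, 10 \rangle$,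 $\langle 5, 7, 5, 9, 9 \rangle$, $\langle 5, 5, 10, 5, 14 \rangle$, $\langle 5, 5, 11, 5, 13 \rangle$. -/

import Mathlib

/-- A rotation system on a simple graph: a permutation of the darts (oriented edges) which, for every
vertex `v`, permutes the darts leaving `v` in one single cycle. The cycle at `v` is the cyclic order
(say counterclockwise) in which the edges at `v` leave `v`. -/
structure RotationSystem {V : Type*} (G : SimpleGraph V) where
  /-- the next dart around the source vertex -/
  next : Equiv.Perm G.Dart
  next_fst : ∀ d : G.Dart, (next d).fst = d.fst
  sameCycle : ∀ d e : G.Dart, d.fst = e.fst → next.SameCycle d e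

namespace RotationSystem

variable {V : Type*} {G : SimpleGraph V}

/-- The face permutation: traverse a dart `u → v`, then leave `v` along the dart that follows `v → u`
in the rotation at `v`. -/
def facePerm (R : RotationSystem G) : Equiv.Perm G.Dart :=
  (Function.Involutive.toPerm SimpleGraph.Dart.symm SimpleGraph.Dart.symm_involutive).trans R.next

/-- The faces are the orbits of the face permutation (closed boundary walks). -/
def Face (R : RotationSystem G) : Type _ :=
  Quotient (Equiv.Perm.SameCycle.setoid R.facePerm)

/-- The face whose boundary walk runs through the dart `d`. -/
def faceOf (R : RotationSystem G) (d : G.Dart) : R.Face :=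
  Quotient.mk (Equiv.Perm.SameCycle.setoid R.facePerm) d

/-- The Euler characteristic `|V| - |E| + |F|` of the closed surface in which the rotation system
embeds the connected component `c` (a component with at least one edge). -/
noncomputable def eulerChar (R : RotationSystem G) (c : G.ConnectedComponent) : ℤ :=
  (Set.ncard {v : V | G.connectedComponentMk v = c} : ℤ)
    - (Set.ncard {e : Sym2 V | e ∈ G.edgeSet ∧ ∀ v ∈ e, G.connectedComponentMk v = c} : ℤ)
    + (Set.ncard {f : R.Face | ∃ d : G.Dart, R.faceOf d = f ∧ G.connectedComponentMk d.fst = c} : ℤ)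

end RotationSystem

/-- A (combinatorial) embedding of a finite simple graph in the oriented sphere, equivalently in the
plane: a rotation system for which the surface carrying each connected component is the sphere, that
is, has Euler characteristic 2. (Isolated vertices, which carry no dart, are no restriction.) -/
structure PlaneEmbedding {V : Type*} (G : SimpleGraph V) extends RotationSystem G where
  spherical : ∀ d : G.Dart, toRotationSystem.eulerChar (G.connectedComponentMk d.fst) = 2

/-- The plane graph contains a `⟨κ 0, κ 1, κ 2, κ 3, κ 4⟩`-star: some vertex of degree five has neighbors
which, listed in cyclic order (in one of the two directions, starting at any neighbor), have degrees
at most `κ 0, …, κ 4`. A bound `⊤` is no restriction. -/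
def PlaneEmbedding.HasCyclicStar {V : Type*} [Fintype V] {G : SimpleGraph V} [DecidableRel G.Adj]
    (E : PlaneEmbedding G) (κ : Fin 5 → ℕ∞) : Prop :=
  ∃ d : G.Dart, G.degree d.fst = 5 ∧
    ((∀ i : Fin 5, (G.degree ((E.next ^ (i : ℕ)) d).snd : ℕ∞) ≤ κ i) ∨
     (∀ i : Fin 5, (G.degree ((E.next⁻¹ ^ (i : ℕ)) d).snd : ℕ∞) ≤ κ i))

/-!
The proof is by discharging. Give a vertex of degree `k` the charge `k - 6`, and let each face of length
at least four send `1 / 2` to each of its corners. By Euler's formula the total charge of a component is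
negative (`RotationSystem.eulerChar_nonpos`), whereas the following rules leave a nonnegative charge at each
vertex if no vertex of degree five is the centre of a listed star.

* A vertex of degree `k ≥ 8` has a share `(k - 6) / k` for each of its edges. It gives the share to the
  neighbour if this has degree five; otherwise it gives half of it to each of the two next neighbours, if
  they have degree five. A vertex of degree `7` gives `1 / 4` to each neighbour of degree five that is next
  to one of larger degree; there are at most four of them.
* A vertex of degree at least six passes the `1 / 2` of a corner that is no triangle on, in two halves, along
  both sides of the corner.
* These rules are too weak for just one kind of vertex `x` of degree five: all its corners are triangles, and
  its neighbours `a, b, w, c, z` have degrees `5, 5, w, 5, z` with `w ∈ {7, 8, 9}`. Then `z` is large, and the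
  deficit of `x` is at most `1 / 4`, `1 / 8`, `1 / 12` for `w = 7, 8, 9`. This amount is given by `a` or by
  `b`. If the second common neighbour of `a` and `b` has degree at least `12`, or if there is none because the
  corner is no triangle, then `a`, which is also adjacent to `z`, has enough to spare. Otherwise `b` gives it,
  out of what it gets in excess of a single share of `w`: either its corner beyond `w` is no triangle, or the next
  neighbour of `w` beyond `b` has degree at least six, as the star of `b` is none of the listed ones.

For a vertex of degree five, all that it gets and gives is bounded in terms of the degrees of its neighbours
and of the set of its triangular corners. The bounds are monotone in the degrees, and degrees above `24` count as
`24`, so a search over boxes of degrees, with bounds for a whole box at a time, shows that the balance is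
nonnegative outside the listed stars (`search_eq_true`, `sumRot_loss_add_le_sumRot_gain`). All amounts
are integers in units of `1 / 720`.

The rules refer to triangles around a dart, and to both directions of rotation. They are set up for any
permutation `n` of a type of darts with a reversal `s`, so that each fact about the rotation `n` also applies to
the opposite rotation `n.symm`.
-/

/-! ### Readings of the neighbourhood of a vertex of degree five -/

/-- Five values in cyclic order: one for each edge at a vertex of degree five, or one for each corner
between consecutive edges there (the entry `a` then belongs to the corner between the edges `a`
and `b`, and so on, and the entry `e` to the corner between `e` and `a`). -/
structure Five (α : Type*) where
  a : α
  b : α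
  c : α
  d : α
  e : α

namespace Five

variable {α : Type*}

/-- The same values, read from the next edge on. -/
def rot (x : Five α) : Five α := ⟨x.b, x.c, x.d, x.e, x.a⟩

/-- Values at the edges, read in the opposite direction from the last edge on. -/
def rev (x : Five α) : Five α := ⟨x.e, x.d, x.c, x.b, x.a⟩

/-- Values at the corners, after the edges have been reversed by `Five.rev`. -/
def revCorner (x : Five α) : Five α := ⟨x.d, x.c, x.b, x.a, x.e⟩

/-- Entrywise comparison. -/
def le (x y : Five ℕ) : Prop := x.a ≤ y.a ∧ x.b ≤ y.b ∧ x.c ≤ y.c ∧ x.d ≤ y.d ∧ x.e ≤ y.e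

/-- Entrywise comparison, as a computation. -/
def ble (x y : Five ℕ) : Bool :=
  Nat.ble x.a y.a && Nat.ble x.b y.b && Nat.ble x.c y.c && Nat.ble x.d y.d && Nat.ble x.e y.e

theorem ble_iff {x y : Five ℕ} : x.ble y = true ↔ x.le y := by
  simp [ble, le, and_assoc]

theorem le.rot {x y : Five ℕ} (h : x.le y) : x.rot.le y.rot :=
  ⟨h.2.1, h.2.2.1, h.2.2.2.1, h.2.2.2.2, h.1⟩

theorem le.rev {x y : Five ℕ} (h : x.le y) : x.rev.le y.rev :=
  ⟨h.2.2.2.2, h.2.2.2.1, h.2.2.1, h.2.1, h.1⟩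

/-- The ten ways to read five values around a vertex: any starting edge, either direction. -/
def readings (q : Five α) : List (Five α) :=
  [q, q.rot, q.rot.rot, q.rot.rot.rot, q.rot.rot.rot.rot,
    q.rev, q.rev.rot, q.rev.rot.rot, q.rev.rot.rot.rot, q.rev.rot.rot.rot.rot]

end Five

/-! ### Local amounts of charge -/

/-- Half of the share `(k - 6) / k` of charge that a vertex of degree `k ≥ 8` has for each of its edges,
in units of `1 / 720` and rounded down. -/
def halfShare (k : ℕ) : ℕ := 360 * (k - 6) / k

/-- The amount for which a vertex with neighbours of degrees `5, 5, w, 5, z` around it asks one of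
the first two, as a function of `w ∈ {7, 8, 9}`. -/
def aid (w : ℕ) : ℕ := if w ≤ 7 then 180 else if w ≤ 8 then 90 else if w ≤ 9 then 60 else 0

/-- A bound for the aid asked for by a vertex with neighbours of degrees `5, 5, w, 5, z` in terms
of `z`: when the star is none of the listed ones, `z` is at least `24`, `16`, `15` for `w = 7, 8, 9`. -/
def aidBound (z : ℕ) : ℕ := if 24 ≤ z then 180 else if 16 ≤ z then 90 else if 15 ≤ z then 60 else 0

/-- What a vertex of degree five obtains from its neighbour `a`, where `y` lists the degrees of the
neighbours and `t` says which corners are triangles. A neighbour of degree at least `8` gives its share,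
and half a share more for each common neighbour of degree at least six next to the edge;
a neighbour of degree `7` gives `1 / 4` if there is such a common neighbour. -/
def fromNeighbor (y : Five ℕ) (t : Five Bool) : ℕ :=
  if y.a ≤ 6 then 0
  else if y.a ≤ 7 then if (t.e = true ∧ 6 ≤ y.e) ∨ (t.a = true ∧ 6 ≤ y.b) then 180 else 0
  else halfShare y.a * (2 + (if t.e = true ∧ 6 ≤ y.e then 1 else 0)
    + (if t.a = true ∧ 6 ≤ y.b then 1 else 0))

/-- What a vertex of degree five obtains through its corner between `a` and `b`, if this is no triangle:
`1 / 2` from the face, and `1 / 4` from each of `a`, `b` that has degree at least six. -/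
def fromCorner (y : Five ℕ) (t : Five Bool) : ℕ :=
  if t.a = true then 0 else 360 + (if 6 ≤ y.a then 180 else 0) + (if 6 ≤ y.b then 180 else 0)

/-- A lower bound for the aid obtained by a vertex with neighbours of degrees `5, 5, w, 5, z`, when the
degrees are known to lie between `l` and `u`. -/
def aidIn (l u : Five ℕ) (t : Five Bool) : ℕ :=
  if u.a ≤ 5 ∧ u.b ≤ 5 ∧ u.d ≤ 5 ∧ 7 ≤ l.c ∧
    t.a = true ∧ t.b = true ∧ t.c = true ∧ t.d = true ∧ t.e = true then aid u.c else 0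

/-- An upper bound for the aid that a vertex gives to its neighbour `b`, when `b` reads its own
neighbours from this vertex on, `a` coming second; the degrees lie between `l` and `u`. -/
def aidFirst (l u : Five ℕ) (t : Five Bool) : ℕ :=
  if l.a ≤ 5 ∧ l.b ≤ 5 ∧ t.a = true ∧ t.b = true ∧ (t.e = false ∨ 12 ≤ u.e) then aidBound u.c else 0

/-- An upper bound for the aid that a vertex gives to its neighbour `a`, when `a` reads its own
neighbours from `b` on, this vertex coming second; the degrees lie between `l` and `u`. -/
def aidSecond (l u : Five ℕ) (t : Five Bool) : ℕ :=
  if l.a ≤ 5 ∧ l.b ≤ 5 ∧ l.c ≤ 11 ∧ t.a = true ∧ t.b = true ∧ t.e = true ∧ 7 ≤ u.e then aid l.e else 0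

/-- A lower bound for the receipts of a vertex of degree five that are attributed to the edge `a`, when the
degrees lie between `l` and `u`. -/
def gain (l u : Five ℕ) (t : Five Bool) : ℕ :=
  fromNeighbor l t + fromCorner l t + aidIn l u t + aidIn l.rev u.rev t.revCorner

/-- An upper bound for the expenses of a vertex of degree five that are attributed to the edge `a`, when the
degrees lie between `l` and `u`. -/
def loss (l u : Five ℕ) (t : Five Bool) : ℕ :=
  aidFirst l u t + aidSecond l u t + aidFirst l.rev u.rev t.revCorner + aidSecond l.rev u.rev t.revCorner

/-- The sum over the five edges. -/
def sumRot (f : Five ℕ → Five ℕ → Five Bool → ℕ) (l u : Five ℕ) (t : Five Bool) : ℕ :=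
  f l u t + f l.rot u.rot t.rot + f l.rot.rot u.rot.rot t.rot.rot
    + f l.rot.rot.rot u.rot.rot.rot t.rot.rot.rot
    + f l.rot.rot.rot.rot u.rot.rot.rot.rot t.rot.rot.rot.rot

theorem halfShare_mono {a b : ℕ} (ha : 6 ≤ a) (h : a ≤ b) : halfShare a ≤ halfShare b := by
  unfold halfShare
  have hq : 360 * (a - 6) / a * a ≤ 360 * (a - 6) := Nat.div_mul_le_self _ _
  have hq' : 360 * (a - 6) / a ≤ 360 :=
    Nat.div_le_of_le_mul (by rw [mul_comm]; exact Nat.mul_le_mul_right _ (Nat.sub_le _ _))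
  rw [Nat.le_div_iff_mul_le (by omega)]
  obtain ⟨k, rfl⟩ := Nat.exists_eq_add_of_le h
  obtain ⟨m, rfl⟩ := Nat.exists_eq_add_of_le ha
  have h1 : 6 + m - 6 = m := by omega
  have h2 : 6 + m + k - 6 = m + k := by omega
  rw [h1] at hq hq'
  rw [h1, h2]
  have := Nat.mul_le_mul_right k hq'
  rw [mul_add (360 * m / (6 + m)) (6 + m) k]
  omega

theorem aid_anti {a b : ℕ} (h : a ≤ b) : aid b ≤ aid a := by
  unfold aid; split_ifs <;> omega

theorem aidBound_mono {a b : ℕ} (h : a ≤ b) : aidBound a ≤ aidBound b := by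
  unfold aidBound; split_ifs <;> omega

theorem fromNeighbor_mono {l y : Five ℕ} (h : l.le y) (t : Five Bool) :
    fromNeighbor l t ≤ fromNeighbor y t := by
  obtain ⟨ha, hb, -, -, he⟩ := h
  have h1 : (if t.e = true ∧ 6 ≤ l.e then 1 else 0) ≤ (if t.e = true ∧ 6 ≤ y.e then 1 else 0) := by
    split_ifs <;> first | omega | (exfalso; grind)
  have h2 : (if t.a = true ∧ 6 ≤ l.b then 1 else 0) ≤ (if t.a = true ∧ 6 ≤ y.b then 1 else 0) := by
    split_ifs <;> first | omega | (exfalso; grind)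
  unfold fromNeighbor
  rcases Nat.lt_or_ge 7 l.a with h7 | h7
  · rw [if_neg (show ¬ l.a ≤ 6 by omega), if_neg (show ¬ l.a ≤ 7 by omega),
      if_neg (show ¬ y.a ≤ 6 by omega), if_neg (show ¬ y.a ≤ 7 by omega)]
    exact Nat.mul_le_mul (halfShare_mono (by omega) ha) (by omega)
  rcases Nat.lt_or_ge 6 l.a with h6 | h6
  · rw [if_neg (show ¬ l.a ≤ 6 by omega), if_pos h7, if_neg (show ¬ y.a ≤ 6 by omega)]
    rcases Nat.lt_or_ge 7 y.a with hy | hy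
    · rw [if_neg (show ¬ y.a ≤ 7 by omega)]
      -- `2 * halfShare 8 = 180`
      have h8 : halfShare 8 ≤ halfShare y.a := halfShare_mono (by omega) hy
      have h90 : halfShare 8 = 90 := rfl
      have h3 : halfShare y.a * 2 ≤ halfShare y.a * (2 + (if t.e = true ∧ 6 ≤ y.e then 1 else 0)
          + (if t.a = true ∧ 6 ≤ y.b then 1 else 0)) := Nat.mul_le_mul_left _ (by omega)
      split_ifs at h3 ⊢ <;> omega
    · rw [if_pos hy]
      split_ifs <;> first | omega | (exfalso; grind)
  · rw [if_pos h6]; exact Nat.zero_le _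

theorem fromCorner_mono {l y : Five ℕ} (h : l.le y) (t : Five Bool) :
    fromCorner l t ≤ fromCorner y t := by
  obtain ⟨ha, hb, -, -, -⟩ := h
  unfold fromCorner
  split_ifs <;> omega

theorem aidIn_le {l y u : Five ℕ} (h : l.le y) (h' : y.le u) (t : Five Bool) :
    aidIn l u t ≤ aidIn y y t := by
  obtain ⟨-, -, hc, -, -⟩ := h
  obtain ⟨ha', hb', hc', hd', -⟩ := h'
  unfold aidIn
  by_cases hl : u.a ≤ 5 ∧ u.b ≤ 5 ∧ u.d ≤ 5 ∧ 7 ≤ l.c ∧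
    t.a = true ∧ t.b = true ∧ t.c = true ∧ t.d = true ∧ t.e = true
  · obtain ⟨h1, h2, h3, h4, h5⟩ := hl
    rw [if_pos ⟨h1, h2, h3, h4, h5⟩, if_pos ⟨by omega, by omega, by omega, by omega, h5⟩]
    exact aid_anti hc'
  · rw [if_neg hl]; exact Nat.zero_le _

theorem aidFirst_le {l y u : Five ℕ} (h : l.le y) (h' : y.le u) (t : Five Bool) :
    aidFirst y y t ≤ aidFirst l u t := by
  obtain ⟨ha, hb, -, -, -⟩ := h
  obtain ⟨-, -, hc', -, he'⟩ := h'
  unfold aidFirst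
  by_cases hl : y.a ≤ 5 ∧ y.b ≤ 5 ∧ t.a = true ∧ t.b = true ∧ (t.e = false ∨ 12 ≤ y.e)
  · obtain ⟨h1, h2, h3, h4, h5⟩ := hl
    rw [if_pos ⟨h1, h2, h3, h4, h5⟩,
      if_pos ⟨by omega, by omega, h3, h4, h5.imp_right fun h => by omega⟩]
    exact aidBound_mono hc'
  · rw [if_neg hl]; exact Nat.zero_le _

theorem aidSecond_le {l y u : Five ℕ} (h : l.le y) (h' : y.le u) (t : Five Bool) :
    aidSecond y y t ≤ aidSecond l u t := by
  obtain ⟨ha, hb, hc, -, he⟩ := h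
  obtain ⟨-, -, -, -, he'⟩ := h'
  unfold aidSecond
  by_cases hl : y.a ≤ 5 ∧ y.b ≤ 5 ∧ y.c ≤ 11 ∧ t.a = true ∧ t.b = true ∧ t.e = true ∧ 7 ≤ y.e
  · obtain ⟨h1, h2, h3, h4, h5, h6, h7⟩ := hl
    rw [if_pos ⟨h1, h2, h3, h4, h5, h6, h7⟩,
      if_pos ⟨by omega, by omega, by omega, h4, h5, h6, by omega⟩]
    exact aid_anti he
  · rw [if_neg hl]; exact Nat.zero_le _

theorem gain_le {l y u : Five ℕ} (h : l.le y) (h' : y.le u) (t : Five Bool) :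
    gain l u t ≤ gain y y t :=
  add_le_add (add_le_add (add_le_add (fromNeighbor_mono h t) (fromCorner_mono h t))
    (aidIn_le h h' t)) (aidIn_le h.rev h'.rev _)

theorem loss_le {l y u : Five ℕ} (h : l.le y) (h' : y.le u) (t : Five Bool) :
    loss y y t ≤ loss l u t :=
  add_le_add (add_le_add (add_le_add (aidFirst_le h h' t) (aidSecond_le h h' t))
    (aidFirst_le h.rev h'.rev _)) (aidSecond_le h.rev h'.rev _)

theorem sumRot_gain_le {l y u : Five ℕ} (h : l.le y) (h' : y.le u) (t : Five Bool) :
    sumRot gain l u t ≤ sumRot gain y y t :=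
  add_le_add (add_le_add (add_le_add (add_le_add (gain_le h h' _) (gain_le h.rot h'.rot _))
    (gain_le h.rot.rot h'.rot.rot _)) (gain_le h.rot.rot.rot h'.rot.rot.rot _))
    (gain_le h.rot.rot.rot.rot h'.rot.rot.rot.rot _)

theorem sumRot_loss_le {l y u : Five ℕ} (h : l.le y) (h' : y.le u) (t : Five Bool) :
    sumRot loss y y t ≤ sumRot loss l u t :=
  add_le_add (add_le_add (add_le_add (add_le_add (loss_le h h' _) (loss_le h.rot h'.rot _))
    (loss_le h.rot.rot h'.rot.rot _)) (loss_le h.rot.rot.rot h'.rot.rot.rot _))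
    (loss_le h.rot.rot.rot.rot h'.rot.rot.rot.rot _)

/-! ### The balance of a vertex of degree five, by a search over boxes of degrees -/

/-- The forty listed types. Degrees are going to be cut off at `24`, so that the entry `24` is no
restriction. -/
def starTypes : List (Five ℕ) :=
  [⟨5, 5, 5, 7, 17⟩, ⟨7, 5, 5, 7, 11⟩, ⟨7, 5, 5, 8, 9⟩, ⟨7, 5, 5, 9, 8⟩,
   ⟨7, 5, 5, 11, 7⟩, ⟨5, 5, 5, 8, 11⟩, ⟨8, 5, 5, 9, 7⟩, ⟨8, 5, 5, 11, 6⟩,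
   ⟨6, 6, 6, 6, 11⟩, ⟨6, 6, 6, 7, 9⟩, ⟨6, 6, 7, 6, 9⟩, ⟨6, 6, 7, 7, 7⟩,
   ⟨6, 7, 6, 7, 7⟩, ⟨5, 6, 6, 8, 9⟩, ⟨5, 6, 8, 6, 9⟩, ⟨5, 6, 7, 7, 9⟩,
   ⟨5, 6, 6, 7, 11⟩, ⟨5, 6, 7, 6, 11⟩, ⟨5, 7, 6, 7, 9⟩, ⟨5, 7, 7, 6, 9⟩,
   ⟨5, 6, 6, 6, 17⟩, ⟨5, 7, 6, 6, 11⟩, ⟨5, 8, 6, 6, 10⟩, ⟨5, 9, 6, 6, 9⟩,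
   ⟨5, 5, 9, 6, 9⟩, ⟨5, 6, 6, 5, 24⟩, ⟨5, 6, 7, 5, 23⟩, ⟨5, 6, 8, 5, 15⟩,
   ⟨5, 6, 9, 5, 14⟩, ⟨5, 9, 5, 6, 10⟩, ⟨5, 8, 5, 6, 11⟩, ⟨5, 7, 5, 6, 17⟩,
   ⟨5, 7, 7, 5, 11⟩, ⟨5, 7, 8, 5, 9⟩, ⟨5, 8, 5, 7, 9⟩, ⟨5, 7, 5, 7, 11⟩,
   ⟨5, 7, 5, 8, 10⟩, ⟨5, 7, 5, 9, 9⟩, ⟨5, 5, 10, 5, 14⟩, ⟨5, 5, 11, 5, 13⟩]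

/-- The listed types in all their readings. -/
def orientedTypes : List (Five ℕ) := starTypes.flatMap Five.readings

/-- The box of all degrees between `l` and `u` is settled if the balance is nonnegative in all of it
or if a single one of the stars in `T` contains all of it. -/
def settled (T : List (Five ℕ)) (t : Five Bool) (l u : Five ℕ) : Bool :=
  Nat.ble (720 + sumRot loss l u t) (sumRot gain l u t) || T.any fun q => u.ble q

/-- Runs through an increasing list, up to a value `k` from which on everything is settled at once
by `above k`; each value `k` before that has to be settled by `here k`. -/
def sweep (above here : ℕ → Bool) : List ℕ → Bool
  | [] => true
  | k :: ks => above k || (here k && sweep above here ks)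

/-- The degrees from `5` to `m`, for `m ≤ 24`. -/
def degreesUpTo (m : ℕ) : List ℕ :=
  [5, 6, 7, 8, 9, 10, 11, 12, 13, 14, 15, 16, 17, 18, 19, 20, 21, 22, 23, 24].filter fun k => k.ble m

/-- The search over the entries `c` and `d`. -/
def searchCD (T : List (Five ℕ)) (t : Five Bool) (a b e : ℕ) : Bool :=
  sweep (fun c => settled T t ⟨a, b, c, 5, e⟩ ⟨a, b, a, a, e⟩)
    (fun c => settled T t ⟨a, b, c, 5, e⟩ ⟨a, b, c, a, e⟩ ||
      sweep (fun d => settled T t ⟨a, b, c, d, e⟩ ⟨a, b, c, a, e⟩)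
        (fun d => settled T t ⟨a, b, c, d, e⟩ ⟨a, b, c, d, e⟩) (degreesUpTo a))
    (degreesUpTo a)

/-- The search over the entries `b`, `e`, `c`, `d`, which are at most `a`. -/
def searchBE (T : List (Five ℕ)) (t : Five Bool) (a : ℕ) : Bool :=
  sweep (fun b => settled T t ⟨a, b, 5, 5, 5⟩ ⟨a, a, a, a, a⟩)
    (fun b => settled T t ⟨a, b, 5, 5, 5⟩ ⟨a, b, a, a, a⟩ ||
      sweep (fun e => settled (T.filter fun q => b.ble q.b) t ⟨a, b, 5, 5, e⟩ ⟨a, b, a, a, a⟩)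
        (fun e => settled (T.filter fun q => b.ble q.b) t ⟨a, b, 5, 5, e⟩ ⟨a, b, a, a, e⟩ ||
          searchCD ((T.filter fun q => b.ble q.b).filter fun q => e.ble q.e) t a b e)
        (degreesUpTo a))
    (degreesUpTo a)

/-- The search over all degrees between `5` and `24` for which the entry `a` is the largest. -/
def search (t : Five Bool) : Bool :=
  sweep (fun a => settled orientedTypes t ⟨a, 5, 5, 5, 5⟩ ⟨24, 24, 24, 24, 24⟩)
    (fun a => settled orientedTypes t ⟨a, 5, 5, 5, 5⟩ ⟨a, a, a, a, a⟩ ||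
      searchBE (orientedTypes.filter fun q => a.ble q.a) t a)
    (degreesUpTo 24)

theorem search_eq_true (t : Five Bool) : search t = true := by
  obtain ⟨p, q, r, s, v⟩ := t
  revert p q r s v
  decide +kernel

theorem settled_sound {T : List (Five ℕ)} {t : Five Bool} {l y u : Five ℕ}
    (h : settled T t l u = true) (hl : l.le y) (hu : y.le u) (hT : ∀ q ∈ T, ¬ y.le q) :
    720 + sumRot loss y y t ≤ sumRot gain y y t := by
  rw [settled, Bool.or_eq_true, Nat.ble_eq, List.any_eq_true] at h
  rcases h with h | ⟨q, hq, h⟩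
  · have h1 := sumRot_gain_le hl hu t
    have h2 := sumRot_loss_le hl hu t
    omega
  · obtain ⟨h1, h2, h3, h4, h5⟩ := Five.ble_iff.1 h
    obtain ⟨k1, k2, k3, k4, k5⟩ := hu
    exact absurd ⟨k1.trans h1, k2.trans h2, k3.trans h3, k4.trans h4, k5.trans h5⟩ (hT q hq)

theorem sweep_sound {Q : ℕ → Prop} {above here : ℕ → Bool} {ks : List ℕ} (hk : ks.Pairwise (· ≤ ·))
    (h : sweep above here ks = true) (ha : ∀ k n, above k = true → k ≤ n → n ∈ ks → Q n)
    (hh : ∀ k, here k = true → Q k) : ∀ n ∈ ks, Q n := by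
  induction ks with
  | nil => simp
  | cons k ks ih =>
    rw [List.pairwise_cons] at hk
    rw [sweep, Bool.or_eq_true, Bool.and_eq_true] at h
    intro n hn
    rcases h with h | ⟨h, h'⟩
    · rcases List.mem_cons.1 hn with rfl | hn'
      · exact ha n n h le_rfl hn
      · exact ha k n h (hk.1 n hn') hn
    · rcases List.mem_cons.1 hn with rfl | hn'
      · exact hh n h
      · exact ih hk.2 h' (fun k n h1 h2 h3 => ha k n h1 h2 (List.mem_cons_of_mem _ h3)) n hn'

theorem pairwise_degreesUpTo (m : ℕ) : (degreesUpTo m).Pairwise (· ≤ ·) :=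
  List.Pairwise.filter _ (by decide)

theorem mem_degreesUpTo {m n : ℕ} (hm : m ≤ 24) : n ∈ degreesUpTo m ↔ 5 ≤ n ∧ n ≤ m := by
  rw [degreesUpTo, List.mem_filter, Nat.ble_eq]
  simp only [List.mem_cons, List.not_mem_nil, or_false]
  omega

theorem balance_of_searchCD {T : List (Five ℕ)} {t : Five Bool} {a b c d e : ℕ}
    (h : searchCD T t a b e = true) (hT : ∀ q ∈ T, ¬ Five.le ⟨a, b, c, d, e⟩ q) (ha : a ≤ 24)
    (hc : 5 ≤ c ∧ c ≤ a) (hd : 5 ≤ d ∧ d ≤ a) :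
    720 + sumRot loss ⟨a, b, c, d, e⟩ ⟨a, b, c, d, e⟩ t ≤
      sumRot gain ⟨a, b, c, d, e⟩ ⟨a, b, c, d, e⟩ t := by
  have key := sweep_sound (Q := fun c => 5 ≤ c ∧ c ≤ a → (∀ q ∈ T, ¬ Five.le ⟨a, b, c, d, e⟩ q) →
    720 + sumRot loss ⟨a, b, c, d, e⟩ ⟨a, b, c, d, e⟩ t ≤
      sumRot gain ⟨a, b, c, d, e⟩ ⟨a, b, c, d, e⟩ t) (pairwise_degreesUpTo a) h ?_ ?_
  · exact key c ((mem_degreesUpTo ha).2 hc) hc hT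
  · intro k n hk hkn _ hn hT
    exact settled_sound hk ⟨le_rfl, le_rfl, hkn, hd.1, le_rfl⟩ ⟨le_rfl, le_rfl, hn.2, hd.2, le_rfl⟩ hT
  · intro n h hn hT
    rw [Bool.or_eq_true] at h
    rcases h with h | h
    · exact settled_sound h ⟨le_rfl, le_rfl, le_rfl, hd.1, le_rfl⟩
        ⟨le_rfl, le_rfl, le_rfl, hd.2, le_rfl⟩ hT
    · have key := sweep_sound (Q := fun d => d ≤ a → (∀ q ∈ T, ¬ Five.le ⟨a, b, n, d, e⟩ q) →
        720 + sumRot loss ⟨a, b, n, d, e⟩ ⟨a, b, n, d, e⟩ t ≤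
          sumRot gain ⟨a, b, n, d, e⟩ ⟨a, b, n, d, e⟩ t) (pairwise_degreesUpTo a) h ?_ ?_
      · exact key d ((mem_degreesUpTo ha).2 hd) hd.2 hT
      · intro k m hk hkm _ hm hT
        exact settled_sound hk ⟨le_rfl, le_rfl, le_rfl, hkm, le_rfl⟩
          ⟨le_rfl, le_rfl, le_rfl, hm, le_rfl⟩ hT
      · intro m hm _ hT
        exact settled_sound hm ⟨le_rfl, le_rfl, le_rfl, le_rfl, le_rfl⟩
          ⟨le_rfl, le_rfl, le_rfl, le_rfl, le_rfl⟩ hT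

theorem balance_of_searchBE {T : List (Five ℕ)} {t : Five Bool} {a b c d e : ℕ}
    (h : searchBE T t a = true) (hT : ∀ q ∈ T, ¬ Five.le ⟨a, b, c, d, e⟩ q) (ha : a ≤ 24)
    (hb : 5 ≤ b ∧ b ≤ a) (hc : 5 ≤ c ∧ c ≤ a) (hd : 5 ≤ d ∧ d ≤ a) (he : 5 ≤ e ∧ e ≤ a) :
    720 + sumRot loss ⟨a, b, c, d, e⟩ ⟨a, b, c, d, e⟩ t ≤
      sumRot gain ⟨a, b, c, d, e⟩ ⟨a, b, c, d, e⟩ t := by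
  have key := sweep_sound (Q := fun b => b ≤ a → (∀ q ∈ T, ¬ Five.le ⟨a, b, c, d, e⟩ q) →
    720 + sumRot loss ⟨a, b, c, d, e⟩ ⟨a, b, c, d, e⟩ t ≤
      sumRot gain ⟨a, b, c, d, e⟩ ⟨a, b, c, d, e⟩ t) (pairwise_degreesUpTo a) h ?_ ?_
  · exact key b ((mem_degreesUpTo ha).2 hb) hb.2 hT
  · intro k n hk hkn _ hn hT
    exact settled_sound hk ⟨le_rfl, hkn, hc.1, hd.1, he.1⟩ ⟨le_rfl, hn, hc.2, hd.2, he.2⟩ hT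
  · intro n h hn hT
    have hT' : ∀ q ∈ T.filter fun q => n.ble q.b, ¬ Five.le ⟨a, n, c, d, e⟩ q :=
      fun q hq => hT q (List.mem_of_mem_filter hq)
    rw [Bool.or_eq_true] at h
    rcases h with h | h
    · exact settled_sound h ⟨le_rfl, le_rfl, hc.1, hd.1, he.1⟩ ⟨le_rfl, le_rfl, hc.2, hd.2, he.2⟩ hT
    · have key := sweep_sound (Q := fun e => e ≤ a →
        (∀ q ∈ T.filter fun q => n.ble q.b, ¬ Five.le ⟨a, n, c, d, e⟩ q) →
        720 + sumRot loss ⟨a, n, c, d, e⟩ ⟨a, n, c, d, e⟩ t ≤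
          sumRot gain ⟨a, n, c, d, e⟩ ⟨a, n, c, d, e⟩ t) (pairwise_degreesUpTo a) h ?_ ?_
      · exact key e ((mem_degreesUpTo ha).2 he) he.2 hT'
      · intro k m hk hkm _ hm hT
        exact settled_sound hk ⟨le_rfl, le_rfl, hc.1, hd.1, hkm⟩ ⟨le_rfl, le_rfl, hc.2, hd.2, hm⟩ hT
      · intro m h hm hT
        rw [Bool.or_eq_true] at h
        rcases h with h | h
        · exact settled_sound h ⟨le_rfl, le_rfl, hc.1, hd.1, le_rfl⟩
            ⟨le_rfl, le_rfl, hc.2, hd.2, le_rfl⟩ hT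
        · exact balance_of_searchCD h (fun q hq => hT q (List.mem_of_mem_filter hq)) ha hc hd

/-- If the star around a vertex of degree five is none of the listed ones, then its receipts exceed its
expenses by at least `1`, which is `720` units. -/
theorem sumRot_loss_add_le_sumRot_gain (t : Five Bool) {y : Five ℕ}
    (hy : ∀ q ∈ orientedTypes, ¬ y.le q) (ha : 5 ≤ y.a ∧ y.a ≤ 24) (hb : 5 ≤ y.b ∧ y.b ≤ y.a)
    (hc : 5 ≤ y.c ∧ y.c ≤ y.a) (hd : 5 ≤ y.d ∧ y.d ≤ y.a) (he : 5 ≤ y.e ∧ y.e ≤ y.a) :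
    720 + sumRot loss y y t ≤ sumRot gain y y t := by
  obtain ⟨a, b, c, d, e⟩ := y
  dsimp only at ha hb hc hd he
  have key := sweep_sound (Q := fun a => a ≤ 24 → b ≤ a → c ≤ a → d ≤ a → e ≤ a →
    (∀ q ∈ orientedTypes, ¬ Five.le ⟨a, b, c, d, e⟩ q) →
    720 + sumRot loss ⟨a, b, c, d, e⟩ ⟨a, b, c, d, e⟩ t ≤
      sumRot gain ⟨a, b, c, d, e⟩ ⟨a, b, c, d, e⟩ t)
    (pairwise_degreesUpTo 24) (search_eq_true t) ?_ ?_
  · exact key a ((mem_degreesUpTo le_rfl).2 ha) ha.2 hb.2 hc.2 hd.2 he.2 hy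
  · intro k n hk hkn _ hn hbn hcn hdn hen hT
    exact settled_sound hk ⟨hkn, hb.1, hc.1, hd.1, he.1⟩
      ⟨hn, hbn.trans hn, hcn.trans hn, hdn.trans hn, hen.trans hn⟩ hT
  · intro n h hn hbn hcn hdn hen hT
    rw [Bool.or_eq_true] at h
    rcases h with h | h
    · exact settled_sound h ⟨le_rfl, hb.1, hc.1, hd.1, he.1⟩ ⟨le_rfl, hbn, hcn, hdn, hen⟩ hT
    · exact balance_of_searchBE h (fun q hq => hT q (List.mem_of_mem_filter hq)) hn
        ⟨hb.1, hbn⟩ ⟨hc.1, hcn⟩ ⟨hd.1, hdn⟩ ⟨he.1, hen⟩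

/-! ### Triangular corners -/

section Corners

variable {D : Type*} (n : Equiv.Perm D) (s : D → D)

/-- The corner between the darts `d` and `n d` is a triangle if the face walk through it closes up
after three steps. -/
def IsTri (d : D) : Prop := s (n (s (n (s (n d))))) = d

variable {n s}

theorem IsTri.next_eq (hs : Function.Involutive s) {d : D} (h : IsTri n s d) :
    n (s (n (s (n d)))) = s d := by
  rw [← hs (n (s (n (s (n d)))))]
  exact congrArg s h

theorem isTri_turn (hs : Function.Involutive s) {d : D} : IsTri n s (s (n d)) ↔ IsTri n s d :=
  ⟨fun h => n.injective (hs.injective h), fun h => congrArg (fun x => s (n x)) h⟩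

theorem isTri_prev_symm (hs : Function.Involutive s) {d : D} :
    IsTri n s (n.symm (s d)) ↔ IsTri n s d := by
  rw [← isTri_turn hs, Equiv.apply_symm_apply, hs]

theorem isTri_symm (hs : Function.Involutive s) {d : D} :
    IsTri n s (s d) ↔ IsTri n s (n.symm d) := by
  rw [← isTri_turn hs (d := n.symm d), Equiv.apply_symm_apply]

theorem isTri_reverse (hs : Function.Involutive s) {d : D} : IsTri n.symm s d ↔ IsTri n s (n.symm d) := by
  unfold IsTri
  rw [Equiv.apply_symm_apply]
  constructor
  · intro h
    have h1 : n (s d) = s (n.symm (s (n.symm d))) := by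
      conv_lhs => rw [← h]
      rw [hs, Equiv.apply_symm_apply]
    rw [h1, hs, Equiv.apply_symm_apply, hs]
  · intro h
    have h1 : n (s (n (s d))) = s (n.symm d) := by rw [← h, hs]
    have h2 : s (n (s d)) = n.symm (s (n.symm d)) := by rw [← h1, Equiv.symm_apply_apply]
    have h3 : n (s d) = s (n.symm (s (n.symm d))) := by rw [← h2, hs]
    rw [← h3, Equiv.symm_apply_apply, hs]

end Corners

/-! ### The flow of charge along the darts -/

section Flow

variable {D : Type*} (n : Equiv.Perm D) (s : D → D) (k : D → ℕ)

/-- The values of `k` at the heads of the darts from `d` on, in the rotation `n`. Here `k` is thought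
of as the degree of the tail of a dart, and `s` as the reversal of darts. -/
def headDegrees (d : D) : Five ℕ :=
  ⟨k (s d), k (s (n d)), k (s (n (n d))), k (s (n (n (n d)))), k (s (n (n (n (n d)))))⟩

open Classical in
/-- The truth value of `IsTri`. -/
noncomputable def triangular (d : D) : Bool := decide (IsTri n s d)

/-- Which of the corners from the one between `d` and `n d` on are triangles. -/
noncomputable def corners (d : D) : Five Bool :=
  ⟨triangular n s d, triangular n s (n d), triangular n s (n (n d)), triangular n s (n (n (n d))),
    triangular n s (n (n (n (n d))))⟩

open Classical in
/-- What the tail of `e`, if of degree at least `7`, gives to the head of `e`, if of degree five. -/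
noncomputable def gift (e : D) : ℕ :=
  if k (s e) = 5 then
    if k e ≤ 6 then 0
    else if k e ≤ 7 then if 6 ≤ k (s (n e)) ∨ 6 ≤ k (s (n.symm e)) then 180 else 0
    else halfShare (k e) * (2 + (if 6 ≤ k (s (n e)) then 1 else 0)
      + (if 6 ≤ k (s (n.symm e)) then 1 else 0))
  else 0

open Classical in
/-- What the tail of `e`, if of degree at least `6`, passes on to the head of `e`, if of degree five, from
the non-triangular corners on both sides of `e`. -/
noncomputable def cornerGift (e : D) : ℕ :=
  if k (s e) = 5 ∧ 6 ≤ k e then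
    (if IsTri n s e then 0 else 180) + (if IsTri n s (n.symm e) then 0 else 180)
  else 0

/-- The aid needed by the tail of `d`, if its neighbours from `d` on have degrees `5, 5, w, 5, z` with
`w ∈ {7, 8, 9}` and all its corners are triangles. -/
noncomputable def aidRequest (d : D) : ℕ :=
  if k d = 5 then aidIn (headDegrees n s k d) (headDegrees n s k d) (corners n s d) else 0

/-- The heads of `d` and `n d` are thought of as adjacent, with a second common neighbour beyond the
tail of `d`. This says that the latter has degree at least `12` or does not exist, because the
corner there is no triangle. -/
def IsRichBeyond (d : D) : Prop := ¬ IsTri n s (n (s (n d))) ∨ 12 ≤ k (s (n (n (s (n d)))))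

open Classical in
/-- The aid that the tail of `d` asks of the head of `d`, as the first of its two consecutive
neighbours of degree five. -/
noncomputable def askFirst (d : D) : ℕ := if IsRichBeyond n s k d then aidRequest n s k d else 0

open Classical in
/-- The aid that the tail of `d` asks of the head of `d`, as the second of its two consecutive
neighbours of degree five. -/
noncomputable def askSecond (d : D) : ℕ :=
  if IsRichBeyond n s k (n.symm d) then 0 else aidRequest n s k (n.symm d)

/-- The aid that the tail of `d` asks of the head of `d`, for both directions of reading. -/
noncomputable def ask (d : D) : ℕ :=
  askFirst n s k d + askSecond n s k d + askFirst n.symm s k d + askSecond n.symm s k d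

/-- All that flows from the head of `d` to the tail of `d`. -/
noncomputable def flow (d : D) : ℕ := gift n s k (s d) + cornerGift n s k (s d) + ask n s k d

variable {n s k}

theorem triangular_eq_true {d : D} : triangular n s d = true ↔ IsTri n s d := by
  simp [triangular]

theorem triangular_eq_false {d : D} : triangular n s d = false ↔ ¬ IsTri n s d := by
  simp [triangular]

theorem headDegrees_next {d : D} (h : n (n (n (n (n d)))) = d) :
    headDegrees n s k (n d) = (headDegrees n s k d).rot := by
  simp only [headDegrees, Five.rot, h]

theorem corners_next {d : D} (h : n (n (n (n (n d)))) = d) :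
    corners n s (n d) = (corners n s d).rot := by
  simp only [corners, Five.rot, h]

theorem symm_eq_of_five {d : D} (h : n (n (n (n (n d)))) = d) : n.symm d = n (n (n (n d))) := by
  rw [Equiv.symm_apply_eq, h]

theorem symm_five {d : D} (h : n (n (n (n (n d)))) = d) : n.symm (n.symm (n.symm (n.symm (n.symm d)))) = d := by
  conv_lhs => rw [← h]
  simp only [Equiv.symm_apply_apply]

theorem headDegrees_reverse {d : D} (h : n (n (n (n (n d)))) = d) :
    headDegrees n.symm s k (n.symm d) = (headDegrees n s k d).rev := by
  simp only [headDegrees, Five.rev, symm_eq_of_five h, Equiv.symm_apply_apply]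

theorem corners_reverse (hs : Function.Involutive s) {d : D} (h : n (n (n (n (n d)))) = d) :
    corners n.symm s (n.symm d) = (corners n s d).revCorner := by
  have h1 : ∀ d, triangular n.symm s d = triangular n s (n.symm d) := fun d => by
    simp only [triangular, decide_eq_decide, isTri_reverse hs]
  simp only [corners, Five.revCorner, h1, symm_eq_of_five h, Equiv.symm_apply_apply]

/-- At a triangular corner, the rotation at the head of `n d` leads from the reversal of `n d` to an
edge to the head of `d`. -/
theorem IsTri.head_next (hs : Function.Involutive s) (hk : ∀ d, k (n d) = k d) {d : D}
    (h : IsTri n s d) : k (s (n (s (n d)))) = k (s d) := by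
  rw [← h.next_eq hs, hk]

/-- At a triangular corner, the rotation at the head of `d` leads to the reversal of `d` from an edge to
the head of `n d`. -/
theorem IsTri.head_prev (hs : Function.Involutive s) (hk : ∀ d, k (n d) = k d) {d : D}
    (h : IsTri n s d) : k (s (n.symm (s d))) = k (s (n d)) := by
  rw [← h.next_eq hs, Equiv.symm_apply_apply, hs, hk]

theorem aid_le_aidBound {y : Five ℕ} (hy : ∀ q ∈ orientedTypes, ¬ y.le q) (ha : y.a ≤ 5)
    (hb : y.b ≤ 5) (hd : y.d ≤ 5) : aid y.c ≤ aidBound y.e := by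
  have mem : ∀ q ∈ starTypes, q ∈ orientedTypes := fun q hq =>
    List.mem_flatMap.2 ⟨q, hq, List.mem_cons_self⟩
  have h7 := hy ⟨5, 6, 7, 5, 23⟩ (mem _ (by simp [starTypes]))
  have h8 := hy ⟨5, 6, 8, 5, 15⟩ (mem _ (by simp [starTypes]))
  have h9 := hy ⟨5, 6, 9, 5, 14⟩ (mem _ (by simp [starTypes]))
  simp only [Five.le] at h7 h8 h9
  unfold aid aidBound
  split_ifs <;> omega

theorem askFirst_le (hs : Function.Involutive s) (hk : ∀ d, k (n d) = k d)
    (h5 : ∀ d, k d = 5 → n (n (n (n (n d)))) = d) (hmin : ∀ d, 5 ≤ k d)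
    (hun : ∀ d, k d = 5 → ∀ q ∈ orientedTypes, ¬ (headDegrees n s k d).le q) (d : D) :
    askFirst n s k d ≤ aidFirst (headDegrees n s k (n.symm (s d)))
      (headDegrees n s k (n.symm (s d))) (corners n s (n.symm (s d))) := by
  unfold askFirst aidRequest aidIn
  split_ifs with hr hd hn
  case neg | neg | neg => all_goals exact Nat.zero_le _
  simp only [headDegrees, corners, triangular_eq_true] at hn
  obtain ⟨hna, hnb, hnd, -, ta, -, -, -, te⟩ := hn
  have hu := aid_le_aidBound (hun d hd) hna hnb hnd
  simp only [headDegrees] at hu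
  rw [← symm_eq_of_five (h5 d hd)] at hu te
  -- `e` is the dart at the head of `d` that leads to the head of `n d`
  set e := s (n (s (n d))) with he
  have hne : n e = s d := ta.next_eq hs
  have hse : s e = n (s (n d)) := hs _
  have hsd : k (s d) = 5 := le_antisymm hna (hmin _)
  have hn5 : n (n (n (n (n e)))) = e := h5 e (by rw [← hk, hne, hsd])
  have hn4 : n (n (n (n e))) = n.symm e := (symm_eq_of_five hn5).symm
  have hte : IsTri n s (n.symm e) ↔ IsTri n s (n (s (n d))) := by
    rw [← isTri_symm hs, hse]
  rw [← hne, Equiv.symm_apply_apply]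
  have hc : k (s (n (n e))) = k (s (n.symm d)) := by
    rw [hne]
    have := te.head_next hs hk
    rwa [Equiv.apply_symm_apply] at this
  unfold aidFirst
  rw [if_pos]
  · simpa only [headDegrees, hc] using hu
  simp only [headDegrees, corners, triangular_eq_true, triangular_eq_false]
  refine ⟨?_, ?_, ?_, ?_, ?_⟩
  · rw [hse, hk]; exact hnb
  · rw [hne, hs, hd]
  · exact (isTri_turn hs).2 ((isTri_turn hs).2 ta)
  · rw [hne, isTri_symm hs]; exact te
  · rw [hn4, hte]
    by_cases hq : IsTri n s (n (s (n d)))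
    · refine Or.inr ((hr.resolve_left (not_not.2 hq)).trans_eq ?_)
      have := (hte.2 hq).head_next hs hk
      rwa [Equiv.apply_symm_apply, hse] at this
    · exact Or.inl hq

theorem askSecond_le (hs : Function.Involutive s) (hk : ∀ d, k (n d) = k d)
    (h5 : ∀ d, k d = 5 → n (n (n (n (n d)))) = d) (hmin : ∀ d, 5 ≤ k d) (d : D) :
    askSecond n s k d ≤ aidSecond (headDegrees n s k (s d)) (headDegrees n s k (s d))
      (corners n s (s d)) := by
  obtain ⟨d, rfl⟩ := n.surjective d
  unfold askSecond aidRequest aidIn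
  rw [Equiv.symm_apply_apply]
  split_ifs with hr hd hn
  case pos | neg | neg => all_goals exact Nat.zero_le _
  simp only [headDegrees, corners, triangular_eq_true] at hn
  obtain ⟨hna, hnb, -, hnc, ta, tb, -, -, -⟩ := hn
  simp only [IsRichBeyond, not_or, not_not, not_le] at hr
  have hsd : k (s (n d)) = 5 := le_antisymm hnb (hmin _)
  have hn4 : n (n (n (n (s (n d))))) = n.symm (s (n d)) := (symm_eq_of_five (h5 _ hsd)).symm
  have hw : k (s (n (n (n (n (s (n d))))))) = k (s (n (n d))) := by
    rw [hn4, tb.head_prev hs hk]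
  unfold aidSecond
  rw [if_pos]
  · simp only [headDegrees, hw]; exact le_rfl
  simp only [headDegrees, corners, triangular_eq_true, hw]
  refine ⟨?_, ?_, ?_, ?_, hr.1, ?_, hnc⟩
  · rw [hs, hk, hd]
  · rw [ta.head_next hs hk]; exact hna
  · omega
  · exact (isTri_turn hs).2 ta
  · rw [hn4, isTri_prev_symm hs]; exact tb

theorem fromNeighbor_le_gift (hs : Function.Involutive s) (hk : ∀ d, k (n d) = k d) {d : D}
    (hd : k d = 5) (h5 : n (n (n (n (n d)))) = d) :
    fromNeighbor (headDegrees n s k d) (corners n s d) ≤ gift n s k (s d) := by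
  have ha : (corners n s d).a = true → k (s (n.symm (s d))) = k (s (n d)) := fun h =>
    (triangular_eq_true.1 h).head_prev hs hk
  have he : (corners n s d).e = true → k (s (n (s d))) = (headDegrees n s k d).e := fun h => by
    have h := triangular_eq_true.1 h
    rw [← symm_eq_of_five h5] at h
    have h := h.head_next hs hk
    rw [Equiv.apply_symm_apply] at h
    rw [h, symm_eq_of_five h5]
    rfl
  have h1 : (if (corners n s d).e = true ∧ 6 ≤ (headDegrees n s k d).e then 1 else 0) ≤
      (if 6 ≤ k (s (n (s d))) then 1 else 0) := by
    split_ifs <;> grind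
  have h2 : (if (corners n s d).a = true ∧ 6 ≤ (headDegrees n s k d).b then 1 else 0) ≤
      (if 6 ≤ k (s (n.symm (s d))) then 1 else 0) := by
    split_ifs <;> grind [headDegrees]
  have h0 : (headDegrees n s k d).a = k (s d) := rfl
  unfold fromNeighbor gift
  rw [h0, hs d, if_pos hd]
  split_ifs at h1 h2 ⊢ <;> first
    | omega
    | exact Nat.mul_le_mul_left _ (by omega)
    | (exfalso; grind)

end Flow

/-! ### The balance of a single vertex -/

section Balance

variable {D : Type*} {n : Equiv.Perm D} {s : D → D} {k : D → ℕ} {S : Finset D}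

theorem sum_next (hS : ∀ d, n d ∈ S ↔ d ∈ S) (F : D → ℕ) : ∑ d ∈ S, F (n d) = ∑ d ∈ S, F d :=
  Finset.sum_equiv n (fun d => (hS d).symm) fun _ _ => rfl

theorem sum_prev (hS : ∀ d, n d ∈ S ↔ d ∈ S) (F : D → ℕ) :
    ∑ d ∈ S, F (n.symm d) = ∑ d ∈ S, F d := by
  rw [← sum_next hS]
  simp only [Equiv.symm_apply_apply]

theorem aidRequest_eq_zero {d : D} (h : 6 ≤ k (s d) ∨ 6 ≤ k (s (n d))) : aidRequest n s k d = 0 := by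
  unfold aidRequest aidIn
  split_ifs with h1 h2
  · simp only [headDegrees] at h2
    omega
  · rfl
  · rfl

theorem ask_symm_eq_zero (hs : Function.Involutive s) {d : D} (hd : 6 ≤ k d) :
    ask n s k (s d) = 0 := by
  have h1 : ∀ n : Equiv.Perm D, askFirst n s k (s d) = 0 := fun n => by
    unfold askFirst
    rw [aidRequest_eq_zero (Or.inl (by rwa [hs])), ite_self]
  have h2 : ∀ n : Equiv.Perm D, askSecond n s k (s d) = 0 := fun n => by
    unfold askSecond
    rw [aidRequest_eq_zero (Or.inr (by rwa [Equiv.apply_symm_apply, hs])), ite_self]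
  simp only [ask, h1, h2]

theorem gift_eq_zero {d : D} (hd : k d ≤ 6) : gift n s k d = 0 := by
  unfold gift
  rw [if_pos hd, ite_self]

theorem cornerGift_eq_zero {d : D} (hd : k d = 5) : cornerGift n s k d = 0 := by
  unfold cornerGift
  rw [if_neg (by omega)]

open Classical in
theorem sum_cornerGift_le (hS : ∀ d, n d ∈ S ↔ d ∈ S) :
    ∑ d ∈ S, cornerGift n s k d ≤ ∑ d ∈ S, if IsTri n s d then 0 else 360 := by
  calc ∑ d ∈ S, cornerGift n s k d
      ≤ ∑ d ∈ S, ((if IsTri n s d then 0 else 180) + if IsTri n s (n.symm d) then 0 else 180) :=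
        Finset.sum_le_sum fun d _ => by
          unfold cornerGift
          split_ifs <;> omega
    _ = ∑ d ∈ S, if IsTri n s d then 0 else 360 := by
        rw [Finset.sum_add_distrib, sum_prev hS fun d => if IsTri n s d then 0 else 180,
          ← Finset.sum_add_distrib]
        exact Finset.sum_congr rfl fun d _ => by split_ifs <;> rfl

theorem two_mul_halfShare_mul_le {m : ℕ} (hm : 6 ≤ m) :
    2 * halfShare (min m 24) * m + 4320 ≤ 720 * m := by
  rcases le_total m 24 with h | h
  · have h1 : halfShare m * m ≤ 360 * (m - 6) := Nat.div_mul_le_self _ _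
    rw [min_eq_left h, mul_assoc]
    omega
  · have h1 : halfShare 24 = 270 := rfl
    rw [min_eq_right h, h1]
    omega

/-- Two neighbours of degree five in each triple of consecutive ones at most are next to a neighbour of
larger degree, hence at most four around a vertex of degree seven. -/
theorem sum_gift_le_of_seven (hS : ∀ d, n d ∈ S ↔ d ∈ S) (hm : S.card = 7)
    (hk : ∀ d ∈ S, k d = 7) : ∑ d ∈ S, gift n s k d ≤ 720 := by
  set c : D → ℕ := fun d =>
    if k (s d) = 5 ∧ (6 ≤ k (s (n d)) ∨ 6 ≤ k (s (n.symm d))) then 1 else 0 with hc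
  have h1 : ∑ d ∈ S, gift n s k d = 180 * ∑ d ∈ S, c d := by
    rw [Finset.mul_sum]
    refine Finset.sum_congr rfl fun d hd => ?_
    have := hk d hd
    simp only [gift, hc]
    split_ifs <;> first | rfl | omega
  have h3 : ∑ d ∈ S, (c d + c (n d) + c (n (n d))) ≤ ∑ d ∈ S, 2 :=
    Finset.sum_le_sum fun d _ => by
      simp only [hc, Equiv.symm_apply_apply]
      split_ifs <;> omega
  rw [Finset.sum_add_distrib, Finset.sum_add_distrib, sum_next hS fun d => c (n d), sum_next hS c,
    Finset.sum_const, hm, smul_eq_mul] at h3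
  omega

/-- A vertex of degree at least six gives away no more than its charge: a neighbour of degree five
takes a full share, and a neighbour of larger degree leaves its share to the two next to it. -/
theorem sum_gift_le (hS : ∀ d, n d ∈ S ↔ d ∈ S) (hm : 6 ≤ S.card)
    (hk : ∀ d ∈ S, k d = min S.card 24) :
    ∑ d ∈ S, gift n s k d + 4320 ≤ 720 * S.card := by
  by_cases h7 : S.card = 7
  · have := sum_gift_le_of_seven (n := n) (s := s) (k := k) hS h7 (fun d hd => by rw [hk d hd, h7]; rfl)
    omega
  by_cases h6 : S.card = 6
  · rw [Finset.sum_eq_zero fun d hd => gift_eq_zero (by rw [hk d hd]; omega), h6]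
  set h := halfShare (min S.card 24) with hh
  have h1 : ∑ d ∈ S, gift n s k d ≤ ∑ d ∈ S, ((if k (s d) = 5 then 2 * h else 0) +
      (if k (s (n d)) = 5 then 0 else h) + (if k (s (n.symm d)) = 5 then 0 else h)) :=
    Finset.sum_le_sum fun d hd => by
      unfold gift
      rw [hk d hd, ← hh, if_neg (show ¬ min S.card 24 ≤ 6 by omega),
        if_neg (show ¬ min S.card 24 ≤ 7 by omega), mul_add, mul_add]
      split_ifs <;> omega
  have h2 : ∑ d ∈ S, ((if k (s d) = 5 then 2 * h else 0) +
      (if k (s (n d)) = 5 then 0 else h) + (if k (s (n.symm d)) = 5 then 0 else h)) =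
      2 * h * S.card := by
    rw [Finset.sum_add_distrib, Finset.sum_add_distrib,
      sum_next hS fun d => if k (s d) = 5 then 0 else h,
      sum_prev hS fun d => if k (s d) = 5 then 0 else h,
      ← Finset.sum_add_distrib, ← Finset.sum_add_distrib, mul_comm (2 * h), ← smul_eq_mul S.card,
      ← Finset.sum_const]
    exact Finset.sum_congr rfl fun d _ => by split_ifs <;> omega
  have h3 := two_mul_halfShare_mul_le hm
  rw [← hh, ← h2] at h3
  exact (Nat.add_le_add_right h1 _).trans h3

theorem sum_ask_symm_le (hs : Function.Involutive s) (hk : ∀ d, k (n d) = k d)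
    (h5 : ∀ d, k d = 5 → n (n (n (n (n d)))) = d) (hmin : ∀ d, 5 ≤ k d)
    (hun : ∀ d, k d = 5 → ∀ q ∈ orientedTypes, ¬ (headDegrees n s k d).le q)
    (hS : ∀ d, n d ∈ S ↔ d ∈ S) :
    ∑ d ∈ S, (askFirst n s k (s d) + askSecond n s k (s d)) ≤
      ∑ d ∈ S, (aidFirst (headDegrees n s k d) (headDegrees n s k d) (corners n s d) +
        aidSecond (headDegrees n s k d) (headDegrees n s k d) (corners n s d)) := by
  rw [Finset.sum_add_distrib, Finset.sum_add_distrib, ← sum_prev hS fun d =>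
    aidFirst (headDegrees n s k d) (headDegrees n s k d) (corners n s d)]
  refine add_le_add (Finset.sum_le_sum fun d _ => ?_) (Finset.sum_le_sum fun d _ => ?_)
  · have := askFirst_le hs hk h5 hmin hun (s d)
    rwa [hs] at this
  · have := askSecond_le hs hk h5 hmin (s d)
    rwa [hs] at this

theorem sum_ask (hS : ∀ d, n d ∈ S ↔ d ∈ S) (h5 : ∀ d ∈ S, k d = 5) :
    ∑ d ∈ S, (askFirst n s k d + askSecond n s k d) =
      ∑ d ∈ S, aidIn (headDegrees n s k d) (headDegrees n s k d) (corners n s d) := by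
  rw [Finset.sum_add_distrib, ← sum_next hS (askSecond n s k), ← Finset.sum_add_distrib]
  refine Finset.sum_congr rfl fun d hd => ?_
  simp only [askFirst, askSecond, Equiv.symm_apply_apply, aidRequest, h5 d hd, if_true]
  by_cases h : IsRichBeyond n s k d <;> simp [h]

/-- Summing over readings in the opposite direction. -/
theorem sum_reverse (hs : Function.Involutive s) (hS : ∀ d, n d ∈ S ↔ d ∈ S)
    (h5 : ∀ d ∈ S, n (n (n (n (n d)))) = d) (f : Five ℕ → Five Bool → ℕ) :
    ∑ d ∈ S, f (headDegrees n.symm s k d) (corners n.symm s d) =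
      ∑ d ∈ S, f (headDegrees n s k d).rev (corners n s d).revCorner := by
  rw [← sum_prev hS fun d => f (headDegrees n.symm s k d) (corners n.symm s d)]
  refine Finset.sum_congr rfl fun d hd => ?_
  rw [headDegrees_reverse (h5 d hd), corners_reverse hs (h5 d hd)]

open Classical in
theorem sum_fromCorner (hs : Function.Involutive s) (hS : ∀ d, n d ∈ S ↔ d ∈ S)
    (hk : ∀ d ∈ S, k d = 5) :
    ∑ d ∈ S, fromCorner (headDegrees n s k d) (corners n s d) =
      ∑ d ∈ S, ((if IsTri n s d then 0 else 360) + cornerGift n s k (s d)) := by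
  set f : D → ℕ := fun d => if IsTri n s d then 0 else if 6 ≤ k (s (n d)) then 180 else 0 with hf
  have h1 : ∀ d ∈ S, fromCorner (headDegrees n s k d) (corners n s d) =
      ((if IsTri n s d then 0 else 360) +
        if IsTri n s d then 0 else if 6 ≤ k (s d) then 180 else 0) + f d := fun d _ => by
    simp only [fromCorner, headDegrees, corners, triangular_eq_true, hf]
    by_cases h : IsTri n s d <;> by_cases h6 : 6 ≤ k (s d) <;>
      by_cases h6' : 6 ≤ k (s (n d)) <;> simp [h, h6, h6']
  have h2 : ∀ d ∈ S, (if IsTri n s d then 0 else 360) + cornerGift n s k (s d) =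
      ((if IsTri n s d then 0 else 360) +
        if IsTri n s d then 0 else if 6 ≤ k (s d) then 180 else 0) + f (n.symm d) := fun d hd => by
    simp only [cornerGift, hf, hs d, hk d hd, isTri_symm hs, isTri_prev_symm hs,
      Equiv.apply_symm_apply]
    by_cases h : IsTri n s d <;> by_cases h' : IsTri n s (n.symm d) <;>
      by_cases h6 : 6 ≤ k (s d) <;> simp [h, h', h6]
  rw [Finset.sum_congr rfl h1, Finset.sum_congr rfl h2, Finset.sum_add_distrib,
    Finset.sum_add_distrib (g := fun d => f (n.symm d)), sum_prev hS f]

theorem sumRot_eq_sum {e : D} (h5 : n (n (n (n (n e)))) = e)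
    (hsum : ∀ F : D → ℕ, ∑ d ∈ S, F d =
      F e + F (n e) + F (n (n e)) + F (n (n (n e))) + F (n (n (n (n e)))))
    (f : Five ℕ → Five ℕ → Five Bool → ℕ) :
    sumRot f (headDegrees n s k e) (headDegrees n s k e) (corners n s e) =
      ∑ d ∈ S, f (headDegrees n s k d) (headDegrees n s k d) (corners n s d) := by
  have h6 : ∀ d, n (n (n (n (n d)))) = d → n (n (n (n (n (n d))))) = n d := fun d h => by rw [h]
  rw [hsum]
  simp only [sumRot, headDegrees_next h5, headDegrees_next (h6 _ h5),
    headDegrees_next (h6 _ (h6 _ h5)), headDegrees_next (h6 _ (h6 _ (h6 _ h5))), corners_next h5,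
    corners_next (h6 _ h5), corners_next (h6 _ (h6 _ h5)), corners_next (h6 _ (h6 _ (h6 _ h5)))]

open Classical in
/-- After the discharging, a vertex of degree five has a nonnegative charge. -/
theorem balance_of_five (hs : Function.Involutive s) (hk : ∀ d, k (n d) = k d)
    (h5 : ∀ d, k d = 5 → n (n (n (n (n d)))) = d) (hmin : ∀ d, 5 ≤ k d) (hmax : ∀ d, k d ≤ 24)
    (hun : ∀ d, k d = 5 → ∀ q ∈ orientedTypes, ¬ (headDegrees n s k d).le q)
    (hun' : ∀ d, k d = 5 → ∀ q ∈ orientedTypes, ¬ (headDegrees n.symm s k d).le q)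
    (hS : ∀ d, n d ∈ S ↔ d ∈ S) (hS5 : ∀ d ∈ S, k d = 5) (hne : S.Nonempty)
    (hsum : ∀ e ∈ S, ∀ F : D → ℕ, ∑ d ∈ S, F d =
      F e + F (n e) + F (n (n e)) + F (n (n (n e))) + F (n (n (n (n e))))) :
    720 + ∑ d ∈ S, flow n s k (s d) ≤
      ∑ d ∈ S, ((if IsTri n s d then 0 else 360) + flow n s k d) := by
  have hr : ∀ d ∈ S, n (n (n (n (n d)))) = d := fun d hd => h5 d (hS5 d hd)
  have hk' : ∀ d, k (n.symm d) = k d := fun d => by rw [← hk, Equiv.apply_symm_apply]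
  have hS' : ∀ d, n.symm d ∈ S ↔ d ∈ S := fun d => by rw [← hS, Equiv.apply_symm_apply]
  -- the receipts
  have hgain : ∑ d ∈ S, gain (headDegrees n s k d) (headDegrees n s k d) (corners n s d) ≤
      ∑ d ∈ S, ((if IsTri n s d then 0 else 360) + flow n s k d) := by
    have h1 := sum_ask (s := s) hS hS5
    have h2 := sum_ask (s := s) hS' hS5
    rw [sum_reverse hs hS hr fun y t => aidIn y y t] at h2
    have h3 := sum_fromCorner hs hS hS5
    have h4 : ∑ d ∈ S, fromNeighbor (headDegrees n s k d) (corners n s d) ≤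
        ∑ d ∈ S, gift n s k (s d) :=
      Finset.sum_le_sum fun d hd => fromNeighbor_le_gift hs hk (hS5 d hd) (hr d hd)
    simp only [gain, flow, ask, Finset.sum_add_distrib] at h1 h2 h3 h4 ⊢
    omega
  -- the expenses
  have hloss : ∑ d ∈ S, flow n s k (s d) ≤
      ∑ d ∈ S, loss (headDegrees n s k d) (headDegrees n s k d) (corners n s d) := by
    have h1 := sum_ask_symm_le hs hk h5 hmin hun hS
    have h2 := sum_ask_symm_le hs hk' (fun d hd => symm_five (h5 d hd)) hmin hun' hS'
    rw [sum_reverse hs hS hr fun y t => aidFirst y y t + aidSecond y y t] at h2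
    have h3 : ∀ d ∈ S, flow n s k (s d) = ask n s k (s d) := fun d hd => by
      rw [flow, hs, gift_eq_zero (by rw [hS5 d hd]; omega), cornerGift_eq_zero (hS5 d hd),
        zero_add, zero_add]
    rw [Finset.sum_congr rfl h3]
    simp only [loss, ask, Finset.sum_add_distrib] at h1 h2 ⊢
    omega
  obtain ⟨e, he, hemax⟩ := S.exists_max_image (fun d => k (s d)) hne
  have hm : ∀ d ∈ S, 5 ≤ k (s d) ∧ k (s d) ≤ k (s e) := fun d hd => ⟨hmin _, hemax d hd⟩
  have he1 := (hS e).2 he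
  have he2 := (hS _).2 he1
  have he3 := (hS _).2 he2
  have he4 := (hS _).2 he3
  have key := sumRot_loss_add_le_sumRot_gain (corners n s e) (hun e (hS5 e he))
    ⟨hmin _, hmax _⟩ (hm _ he1) (hm _ he2) (hm _ he3) (hm _ he4)
  rw [sumRot_eq_sum (hr e he) (hsum e he), sumRot_eq_sum (hr e he) (hsum e he)] at key
  omega

open Classical in
/-- After the discharging, a vertex of degree at least six has a nonnegative charge. -/
theorem balance_of_six_le (hs : Function.Involutive s) (hS : ∀ d, n d ∈ S ↔ d ∈ S)
    (hm : 6 ≤ S.card) (hk : ∀ d ∈ S, k d = min S.card 24) :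
    4320 + ∑ d ∈ S, flow n s k (s d) ≤
      720 * S.card + ∑ d ∈ S, ((if IsTri n s d then 0 else 360) + flow n s k d) := by
  have h1 := sum_gift_le (s := s) hS hm hk
  have h2 := sum_cornerGift_le (s := s) (k := k) hS
  have h3 : ∀ d ∈ S, flow n s k (s d) = gift n s k d + cornerGift n s k d := fun d hd => by
    rw [flow, hs, ask_symm_eq_zero hs (by rw [hk d hd]; omega), add_zero]
  rw [Finset.sum_congr rfl h3, Finset.sum_add_distrib, Finset.sum_add_distrib]
  omega

end Balance

/-! ### Euler's formula for the component of a dart -/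

section Euler

open SimpleGraph

variable {V : Type*} {G : SimpleGraph V}

namespace RotationSystem

theorem facePerm_apply (R : RotationSystem G) (d : G.Dart) : R.facePerm d = R.next d.symm := rfl

theorem facePerm_fst (R : RotationSystem G) (d : G.Dart) : (R.facePerm d).fst = d.snd :=
  R.next_fst d.symm

theorem facePerm_ne_self (R : RotationSystem G) (d : G.Dart) : R.facePerm d ≠ d := fun h =>
  d.adj.ne (by rw [← R.facePerm_fst d, h])

theorem faceOf_facePerm (R : RotationSystem G) (d : G.Dart) : R.faceOf (R.facePerm d) = R.faceOf d :=
  Quotient.sound (Equiv.Perm.SameCycle.symm ⟨1, by simp⟩)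

theorem connectedComponentMk_snd (d : G.Dart) :
    G.connectedComponentMk d.snd = G.connectedComponentMk d.fst :=
  (ConnectedComponent.connectedComponentMk_eq_of_adj d.adj).symm

theorem connectedComponentMk_facePerm (R : RotationSystem G) (d : G.Dart) :
    G.connectedComponentMk (R.facePerm d).fst = G.connectedComponentMk d.fst := by
  rw [facePerm_fst, connectedComponentMk_snd]

theorem isTri_iff (R : RotationSystem G) (d : G.Dart) :
    IsTri R.next Dart.symm d ↔
      R.facePerm (R.facePerm (R.facePerm (R.next d))) = R.next d := by
  simp only [facePerm_apply, IsTri]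
  exact ⟨fun h => congrArg _ h, fun h => R.next.injective h⟩

variable [Fintype V] [DecidableEq V] [DecidableRel G.Adj]

theorem mem_darts_next (R : RotationSystem G) (v : V) (d : G.Dart) :
    R.next d ∈ ({d | d.fst = v} : Finset G.Dart) ↔ d ∈ ({d | d.fst = v} : Finset G.Dart) := by
  simp only [Finset.mem_filter, Finset.mem_univ, true_and, R.next_fst]

/-- The darts at a vertex are run through by the iterates of the rotation. -/
theorem image_iterate_next (R : RotationSystem G) (d : G.Dart) :
    (Finset.range (G.degree d.fst)).image (fun i => R.next^[i] d) =
        ({e | e.fst = d.fst} : Finset G.Dart) ∧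
      Set.InjOn (fun i => R.next^[i] d) (Finset.range (G.degree d.fst)) ∧
      R.next^[G.degree d.fst] d = d := by
  set p := Function.minimalPeriod R.next d with hp
  have hpos : 0 < p := Function.minimalPeriod_pos_of_mem_periodicPts
    (Function.Injective.mem_periodicPts R.next.injective d)
  have himg : (Finset.range p).image (fun i => R.next^[i] d) =
      ({e | e.fst = d.fst} : Finset G.Dart) := by
    ext e
    simp only [Finset.mem_image, Finset.mem_range, Finset.mem_filter, Finset.mem_univ, true_and]
    constructor
    · rintro ⟨i, -, rfl⟩
      clear hp hpos
      induction i with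
      | zero => rfl
      | succ i ih => rw [Function.iterate_succ_apply', R.next_fst, ih]
    · intro he
      obtain ⟨i, -, rfl⟩ := (R.sameCycle d e he.symm).exists_pow_eq'
      refine ⟨i % p, Nat.mod_lt _ hpos, ?_⟩
      rw [hp, Function.iterate_mod_minimalPeriod_eq, Equiv.Perm.iterate_eq_pow]
  have hinj : Set.InjOn (fun i => R.next^[i] d) (Finset.range p) := by
    rw [Finset.coe_range]
    exact Function.iterate_injOn_Iio_minimalPeriod
  have hcard : p = G.degree d.fst := by
    rw [← G.dart_fst_fiber_card_eq_degree d.fst, ← himg, Finset.card_image_of_injOn hinj,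
      Finset.card_range]
  rw [← hcard]
  exact ⟨himg, hinj, Function.iterate_minimalPeriod⟩

theorem next_five (R : RotationSystem G) {d : G.Dart} (hd : G.degree d.fst = 5) :
    R.next (R.next (R.next (R.next (R.next d)))) = d := by
  have := (R.image_iterate_next d).2.2
  rwa [hd] at this

theorem sum_darts_of_five (R : RotationSystem G) {d : G.Dart} (hd : G.degree d.fst = 5)
    (F : G.Dart → ℕ) :
    ∑ e ∈ {e : G.Dart | e.fst = d.fst}, F e = F d + F (R.next d) + F (R.next (R.next d)) +
      F (R.next (R.next (R.next d))) + F (R.next (R.next (R.next (R.next d)))) := by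
  obtain ⟨h1, h2, -⟩ := R.image_iterate_next d
  rw [← h1, Finset.sum_image h2, hd]
  simp [Finset.sum_range_succ]

/-- A face walk does not return after two steps: otherwise it would turn back at a vertex of degree
one. -/
theorem facePerm_facePerm_ne_self (R : RotationSystem G) (hG : ∀ v, 2 ≤ G.degree v) (d : G.Dart) :
    R.facePerm (R.facePerm d) ≠ d := by
  intro h
  have h1 : R.facePerm d = d.symm := by
    refine Dart.ext _ _ (Prod.ext (R.facePerm_fst d) ?_)
    change (R.facePerm d).snd = d.fst
    rw [← R.facePerm_fst (R.facePerm d), h]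
  obtain ⟨-, h2, -⟩ := R.image_iterate_next d.symm
  have h3 : 1 < G.degree d.symm.fst := hG d.snd
  have h4 : (fun i => R.next^[i] d.symm) 0 = (fun i => R.next^[i] d.symm) 1 := h1.symm
  exact absurd (h2 (Finset.mem_coe.2 (Finset.mem_range.2 (by omega)))
    (Finset.mem_coe.2 (Finset.mem_range.2 h3)) h4) zero_ne_one

open Classical in
/-- A set of darts that is closed under face walks has at least three elements, and at least four if it
contains a dart of a face that is no triangle. -/
theorem twelve_add_card_le (R : RotationSystem G) (hG : ∀ v, 2 ≤ G.degree v) {T : Finset G.Dart}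
    (hT : ∀ d ∈ T, R.facePerm d ∈ T) (hne : T.Nonempty) :
    12 + (T.filter fun d => R.facePerm (R.facePerm (R.facePerm d)) ≠ d).card ≤ 4 * T.card := by
  have hφ := R.facePerm.injective
  have h1 := R.facePerm_ne_self
  have h2 := R.facePerm_facePerm_ne_self hG
  rcases (T.filter fun d => R.facePerm (R.facePerm (R.facePerm d)) ≠ d).eq_empty_or_nonempty with
    h | ⟨d, hd⟩
  · obtain ⟨d, hd⟩ := hne
    have hsub : {d, R.facePerm d, R.facePerm (R.facePerm d)} ⊆ T := by
      simp only [Finset.insert_subset_iff, Finset.singleton_subset_iff]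
      exact ⟨hd, hT _ hd, hT _ (hT _ hd)⟩
    have := Finset.card_le_card hsub
    rw [Finset.card_eq_three.2 ⟨_, _, _, (h1 d).symm, (h2 d).symm, (h1 _).symm, rfl⟩] at this
    rw [h, Finset.card_empty]
    omega
  · obtain ⟨hd, h3⟩ := Finset.mem_filter.1 hd
    have hsub : {d, R.facePerm d, R.facePerm (R.facePerm d),
        R.facePerm (R.facePerm (R.facePerm d))} ⊆ T := by
      simp only [Finset.insert_subset_iff, Finset.singleton_subset_iff]
      exact ⟨hd, hT _ hd, hT _ (hT _ hd), hT _ (hT _ (hT _ hd))⟩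
    have := Finset.card_le_card hsub
    rw [Finset.card_insert_of_notMem, Finset.card_eq_three.2
      ⟨_, _, _, (h1 _).symm, (h2 _).symm, (h1 _).symm, rfl⟩] at this
    · have := Finset.card_filter_le T fun d => R.facePerm (R.facePerm (R.facePerm d)) ≠ d
      omega
    · simp only [Finset.mem_insert, Finset.mem_singleton, not_or]
      exact ⟨(h1 d).symm, (h2 d).symm, h3.symm⟩

open Classical in
theorem twelve_mul_faces_add_le (R : RotationSystem G) (hG : ∀ v, 2 ≤ G.degree v)
    (c : G.ConnectedComponent) {A : Finset G.Dart}
    (hA : ∀ d, d ∈ A ↔ G.connectedComponentMk d.fst = c) :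
    12 * Set.ncard {f : R.Face | ∃ d : G.Dart, R.faceOf d = f ∧ G.connectedComponentMk d.fst = c} +
      (A.filter fun d => ¬ IsTri R.next Dart.symm d).card ≤ 4 * A.card := by
  have h1 : {f : R.Face | ∃ d : G.Dart, R.faceOf d = f ∧ G.connectedComponentMk d.fst = c} =
      ↑(A.image R.faceOf) := by
    ext f
    simp [hA, and_comm]
  have h2 : (A.filter fun d => ¬ IsTri R.next Dart.symm d).card =
      (A.filter fun d => R.facePerm (R.facePerm (R.facePerm d)) ≠ d).card := by
    refine Finset.card_equiv R.next fun d => ?_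
    rw [Finset.mem_filter, Finset.mem_filter, hA, hA, R.next_fst, R.isTri_iff]
  rw [h1, Set.ncard_coe_finset, h2, Finset.card_eq_sum_card_image R.faceOf A,
    Finset.card_eq_sum_card_fiberwise (s := A.filter _) (t := A.image R.faceOf) (f := R.faceOf)
      fun d hd => Finset.mem_coe.2 (Finset.mem_image_of_mem _ (Finset.mem_filter.1 hd).1),
    mul_comm, ← smul_eq_mul, ← Finset.sum_const, ← Finset.sum_add_distrib, Finset.mul_sum]
  refine Finset.sum_le_sum fun f hf => ?_
  obtain ⟨d, hd, rfl⟩ := Finset.mem_image.1 hf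
  have := R.twelve_add_card_le hG (T := A.filter fun e => R.faceOf e = R.faceOf d) (fun e he => ?_)
    ⟨d, Finset.mem_filter.2 ⟨hd, rfl⟩⟩
  · rwa [Finset.filter_filter, Finset.filter_congr fun e _ => and_comm, ← Finset.filter_filter]
      at this
  · rw [Finset.mem_filter, hA] at he ⊢
    rw [R.connectedComponentMk_facePerm, R.faceOf_facePerm]
    exact he

theorem card_darts_le (c : G.ConnectedComponent) {A : Finset G.Dart}
    (hA : ∀ d, d ∈ A ↔ G.connectedComponentMk d.fst = c) :
    A.card ≤ 2 * Set.ncard {e : Sym2 V | e ∈ G.edgeSet ∧ ∀ v ∈ e, G.connectedComponentMk v = c} := by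
  have h1 : A.card ≤ 2 * (A.image Dart.edge).card := by
    refine Finset.card_le_mul_card_image A 2 fun e he => ?_
    obtain ⟨d, -, rfl⟩ := Finset.mem_image.1 he
    rw [← G.dart_edge_fiber_card d.edge d.edge_mem]
    exact Finset.card_le_card (Finset.filter_subset_filter _ (Finset.subset_univ _))
  refine h1.trans (Nat.mul_le_mul_left _ ?_)
  rw [← Set.ncard_coe_finset]
  refine Set.ncard_le_ncard (fun e he => ?_) (Set.toFinite _)
  obtain ⟨d, hd, rfl⟩ := Finset.mem_image.1 (Finset.mem_coe.1 he)
  rw [hA] at hd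
  refine ⟨d.edge_mem, fun v hv => ?_⟩
  rcases Sym2.mem_iff.1 (show v ∈ s(d.fst, d.snd) from hv) with rfl | rfl
  · exact hd
  · rw [connectedComponentMk_snd, hd]

end RotationSystem

open Classical in
/-- If a flow of charge along the darts leaves a nonnegative charge at each vertex, then the Euler
characteristic of the component is at most zero. -/
theorem RotationSystem.eulerChar_nonpos [Fintype V] [DecidableRel G.Adj] (R : RotationSystem G)
    (hG : ∀ v, 2 ≤ G.degree v) (c : G.ConnectedComponent) (F : G.Dart → ℕ)
    (hF : ∀ v, 4320 + ∑ d ∈ {d : G.Dart | d.fst = v}, F d.symm ≤ 720 * G.degree v +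
      ∑ d ∈ {d : G.Dart | d.fst = v}, ((if IsTri R.next Dart.symm d then 0 else 360) + F d)) :
    R.eulerChar c ≤ 0 := by
  set A : Finset G.Dart := {d | G.connectedComponentMk d.fst = c} with hA
  set B : Finset V := {v | G.connectedComponentMk v = c} with hB
  have hmem : ∀ d, d ∈ A ↔ G.connectedComponentMk d.fst = c := fun d => by simp [hA]
  have hfib : ∀ f : G.Dart → ℕ, ∑ v ∈ B, ∑ d ∈ {d : G.Dart | d.fst = v}, f d = ∑ d ∈ A, f d := by
    intro f
    rw [← Finset.sum_fiberwise_of_maps_to (s := A) (t := B) (g := fun d => d.fst)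
      (fun d hd => by simpa [hB, hA] using hd)]
    refine Finset.sum_congr rfl fun v hv => Finset.sum_congr ?_ fun _ _ => rfl
    ext d
    simp only [hA, hB, Finset.mem_filter, Finset.mem_univ, true_and] at hv ⊢
    exact ⟨fun h => ⟨by rw [h, hv], h⟩, fun h => h.2⟩
  have hsymm : ∑ d ∈ A, F d.symm = ∑ d ∈ A, F d :=
    Finset.sum_equiv (Function.Involutive.toPerm Dart.symm Dart.symm_involutive)
      (fun d => by
        rw [hmem, hmem]
        exact Eq.congr_left (RotationSystem.connectedComponentMk_snd d).symm) fun _ _ => rfl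
  have hdeg : ∑ v ∈ B, G.degree v = A.card := by
    have := hfib fun _ => 1
    simpa only [← Finset.card_eq_sum_ones, G.dart_fst_fiber_card_eq_degree] using this
  have hV : 12 * B.card ≤ 2 * A.card + (A.filter fun d => ¬ IsTri R.next Dart.symm d).card := by
    have h := Finset.sum_le_sum fun v (_ : v ∈ B) => hF v
    rw [Finset.sum_add_distrib, Finset.sum_add_distrib, hfib, hfib, ← Finset.mul_sum, hdeg,
      Finset.sum_add_distrib, hsymm, Finset.sum_const, smul_eq_mul] at h
    have h' : ∑ d ∈ A, (if IsTri R.next Dart.symm d then 0 else 360) =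
        360 * (A.filter fun d => ¬ IsTri R.next Dart.symm d).card := by
      rw [Finset.card_filter, Finset.mul_sum]
      exact Finset.sum_congr rfl fun d _ => by split_ifs <;> rfl
    omega
  have hF := R.twelve_mul_faces_add_le hG c hmem
  have hE := RotationSystem.card_darts_le c hmem
  have hV' : Set.ncard {v : V | G.connectedComponentMk v = c} = B.card := by
    rw [← Set.ncard_coe_finset]
    congr 1
    ext v
    simp [hB]
  unfold RotationSystem.eulerChar
  rw [hV']
  omega

end Euler

/-! ### The listed stars in a plane graph -/

theorem exists_rot_le_of_mem_readings {x q y : Five ℕ} (hq : q ∈ x.readings) (h : y.le q) :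
    ∃ z ∈ [y, y.rot, y.rot.rot, y.rot.rot.rot, y.rot.rot.rot.rot], z.le x ∨ z.rev.le x := by
  simp only [Five.readings, List.mem_cons, List.not_mem_nil, or_false] at hq
  rcases hq with rfl | rfl | rfl | rfl | rfl | rfl | rfl | rfl | rfl | rfl
  · exact ⟨y, by simp, Or.inl h⟩
  · exact ⟨y.rot.rot.rot.rot, by simp, Or.inl h.rot.rot.rot.rot⟩
  · exact ⟨y.rot.rot.rot, by simp, Or.inl h.rot.rot.rot⟩
  · exact ⟨y.rot.rot, by simp, Or.inl h.rot.rot⟩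
  · exact ⟨y.rot, by simp, Or.inl h.rot⟩
  · exact ⟨y, by simp, Or.inr h.rev⟩
  · exact ⟨y.rot.rot.rot.rot, by simp, Or.inr h.rot.rot.rot.rot.rev⟩
  · exact ⟨y.rot.rot.rot, by simp, Or.inr h.rot.rot.rot.rev⟩
  · exact ⟨y.rot.rot, by simp, Or.inr h.rot.rot.rev⟩
  · exact ⟨y.rot, by simp, Or.inr h.rot.rev⟩

/-- A listed type that contains the star around a dart in some reading contains it in the original
reading when the star is read from another dart, in one of the two directions. -/
theorem not_le_of_starTypes {D : Type*} {n : Equiv.Perm D} {s : D → D} {k : D → ℕ}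
    (hk : ∀ d, k (n d) = k d) (h5 : ∀ d, k d = 5 → n (n (n (n (n d)))) = d)
    (h : ∀ d, k d = 5 → ∀ q ∈ starTypes, ¬ (headDegrees n s k d).le q)
    (h' : ∀ d, k d = 5 → ∀ q ∈ starTypes, ¬ (headDegrees n.symm s k d).le q) (d : D)
    (hd : k d = 5) (q : Five ℕ) (hq : q ∈ orientedTypes) : ¬ (headDegrees n s k d).le q := by
  intro hle
  obtain ⟨x, hx, hq⟩ := List.mem_flatMap.1 hq
  obtain ⟨z, hz, hzx⟩ := exists_rot_le_of_mem_readings hq hle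
  have key : ∃ e, k e = 5 ∧ z = headDegrees n s k e := by
    have h1 : k (n d) = 5 := by rw [hk, hd]
    have h2 : k (n (n d)) = 5 := by rw [hk, h1]
    have h3 : k (n (n (n d))) = 5 := by rw [hk, h2]
    have h4 : k (n (n (n (n d)))) = 5 := by rw [hk, h3]
    rw [← headDegrees_next (h5 _ hd), ← headDegrees_next (h5 _ h1), ← headDegrees_next (h5 _ h2),
      ← headDegrees_next (h5 _ h3)] at hz
    simp only [List.mem_cons, List.not_mem_nil, or_false] at hz
    rcases hz with hz | hz | hz | hz | hz
    exacts [⟨_, hd, hz⟩, ⟨_, h1, hz⟩, ⟨_, h2, hz⟩, ⟨_, h3, hz⟩, ⟨_, h4, hz⟩]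
  obtain ⟨e, he, rfl⟩ := key
  rcases hzx with hzx | hzx
  · exact h e he x hx hzx
  · rw [← headDegrees_reverse (h5 e he)] at hzx
    exact h' _ (by rw [← hk, Equiv.apply_symm_apply, he]) x hx hzx

/-- A degree bound as it appears in the list of types: the cut-off `24` stands for no restriction. -/
def uncut (m : ℕ) : ℕ∞ := if 24 ≤ m then ⊤ else m

theorem le_uncut {j m : ℕ} (h : min j 24 ≤ m) : (j : ℕ∞) ≤ uncut m := by
  unfold uncut
  split_ifs with hm
  · exact le_top
  · exact Nat.cast_le.2 (by omega)

/-- The bounds on the degrees that belong to a listed type. -/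
def Five.bounds (q : Five ℕ) : Fin 5 → ℕ∞ := ![uncut q.a, uncut q.b, uncut q.c, uncut q.d, uncut q.e]

theorem PlaneEmbedding.not_le_of_not_hasCyclicStar {V : Type*} [Fintype V] {G : SimpleGraph V}
    [DecidableRel G.Adj] (E : PlaneEmbedding G) {q : Five ℕ} (hq : ¬ E.HasCyclicStar q.bounds)
    {d : G.Dart} (hd : G.degree d.fst = 5) :
    ¬ (headDegrees E.next SimpleGraph.Dart.symm (fun d => min (G.degree d.fst) 24) d).le q ∧
      ¬ (headDegrees E.next.symm SimpleGraph.Dart.symm (fun d => min (G.degree d.fst) 24) d).le q := by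
  constructor
  · rintro ⟨h0, h1, h2, h3, h4⟩
    refine hq ⟨d, hd, Or.inl fun i => ?_⟩
    fin_cases i
    exacts [le_uncut h0, le_uncut h1, le_uncut h2, le_uncut h3, le_uncut h4]
  · rintro ⟨h0, h1, h2, h3, h4⟩
    refine hq ⟨d, hd, Or.inr fun i => ?_⟩
    fin_cases i
    exacts [le_uncut h0, le_uncut h1, le_uncut h2, le_uncut h3, le_uncut h4]

open Classical in
theorem PlaneEmbedding.exists_hasCyclicStar {V : Type*} [Fintype V] {G : SimpleGraph V}
    [DecidableRel G.Adj] (E : PlaneEmbedding G) (hG : G.minDegree = 5) :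
    ∃ q ∈ starTypes, E.HasCyclicStar q.bounds := by
  by_contra! hno
  have hdeg : ∀ v, 5 ≤ G.degree v := fun v => hG ▸ G.minDegree_le_degree v
  set n := E.next with hn
  set s : G.Dart → G.Dart := SimpleGraph.Dart.symm with hs
  set k : G.Dart → ℕ := fun d => min (G.degree d.fst) 24 with hk
  have hs' : Function.Involutive s := SimpleGraph.Dart.symm_involutive
  have hkn : ∀ d, k (n d) = k d := fun d =>
    congrArg (fun v => min (G.degree v) 24) (E.next_fst d)
  have hkn' : ∀ d, k (n.symm d) = k d := fun d => by rw [← hkn, Equiv.apply_symm_apply]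
  have hk5 : ∀ d, k d = 5 → G.degree d.fst = 5 := fun d h => by simp only [hk] at h; omega
  have h5 : ∀ d, k d = 5 → n (n (n (n (n d)))) = d := fun d h => E.next_five (hk5 d h)
  have hun : ∀ d, k d = 5 → ∀ q ∈ starTypes, ¬ (headDegrees n s k d).le q := fun d h q hq =>
    (E.not_le_of_not_hasCyclicStar (hno q hq) (hk5 d h)).1
  have hun' : ∀ d, k d = 5 → ∀ q ∈ starTypes, ¬ (headDegrees n.symm s k d).le q := fun d h q hq =>
    (E.not_le_of_not_hasCyclicStar (hno q hq) (hk5 d h)).2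
  have hmin : ∀ d, 5 ≤ k d := fun d => le_min (hdeg _) (by norm_num)
  -- there is a dart, because the minimum degree of the empty graph is zero
  obtain ⟨d⟩ : Nonempty G.Dart := by
    have : Nonempty V := by
      by_contra h
      rw [not_nonempty_iff] at h
      simp [SimpleGraph.minDegree_of_subsingleton] at hG
    obtain ⟨v⟩ := this
    obtain ⟨w, hw⟩ := (G.degree_pos_iff_exists_adj v).1 ((hdeg v).trans_lt' (by norm_num))
    exact ⟨⟨(v, w), hw⟩⟩
  have hle := E.eulerChar_nonpos (fun v => (hdeg v).trans' (by norm_num))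
    (G.connectedComponentMk d.fst) (flow n s k) fun v => ?_
  · rw [E.spherical d] at hle
    exact absurd hle (by norm_num)
  have hS := E.mem_darts_next v
  have hcard := G.dart_fst_fiber_card_eq_degree v
  have hSv : ∀ e ∈ ({e | e.fst = v} : Finset G.Dart), e.fst = v := fun e he => by simpa using he
  have hkv : ∀ e ∈ ({e | e.fst = v} : Finset G.Dart), k e = min (G.degree v) 24 := fun e he =>
    congrArg (fun v => min (G.degree v) 24) (hSv e he)
  rcases (hdeg v).eq_or_lt with hv | hv
  · have h1 := balance_of_five hs' hkn h5 hmin (fun d => min_le_right _ _)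
      (not_le_of_starTypes hkn h5 hun hun')
      (not_le_of_starTypes hkn' (fun d h => symm_five (h5 d h)) hun' hun) hS
      (fun e he => (hkv e he).trans (by rw [← hv]; rfl))
      (Finset.card_pos.1 (by rw [hcard]; omega))
      (fun e he F => by
        have := E.sum_darts_of_five (by rw [hSv e he, ← hv] : G.degree e.fst = 5) F
        rwa [hSv e he] at this)
    rw [← hv, show 4320 = 720 * 5 + 720 from rfl, add_assoc]
    exact Nat.add_le_add_left h1 _
  · have h1 := balance_of_six_le (k := k) hs' hS (by rw [hcard]; exact hv)
      (fun e he => (hkv e he).trans (by rw [hcard]))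
    rwa [hcard] at h1

theorem theorem12 {V : Type*} [Fintype V] (G : SimpleGraph V) [DecidableRel G.Adj]
    (E : PlaneEmbedding G) (hG : G.minDegree = 5) :
    ∃ κ ∈ ({
        ![5, 5, 5, 7, 17], ![7, 5, 5, 7, 11], ![7, 5, 5, 8, 9], ![7, 5, 5, 9, 8],
        ![7, 5, 5, 11, 7], ![5, 5, 5, 8, 11], ![8, 5, 5, 9, 7], ![8, 5, 5, 11, 6],
        ![6, 6, 6, 6, 11], ![6, 6, 6, 7, 9], ![6, 6, 7, 6, 9], ![6, 6, 7, 7, 7],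
        ![6, 7, 6, 7, 7], ![5, 6, 6, 8, 9], ![5, 6, 8, 6, 9], ![5, 6, 7, 7, 9],
        ![5, 6, 6, 7, 11], ![5, 6, 7, 6, 11], ![5, 7, 6, 7, 9], ![5, 7, 7, 6, 9],
        ![5, 6, 6, 6, 17], ![5, 7, 6, 6, 11], ![5, 8, 6, 6, 10], ![5, 9, 6, 6, 9],
        ![5, 5, 9, 6, 9], ![5, 6, 6, 5, ⊤], ![5, 6, 7, 5, 23], ![5, 6, 8, 5, 15],
        ![5, 6, 9, 5, 14], ![5, 9, 5, 6, 10], ![5, 8, 5, 6, 11], ![5, 7, 5, 6, 17],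
        ![5, 7, 7, 5, 11], ![5, 7, 8, 5, 9], ![5, 8, 5, 7, 9], ![5, 7, 5, 7, 11],
        ![5, 7, 5, 8, 10], ![5, 7, 5, 9, 9], ![5, 5, 10, 5, 14], ![5, 5, 11, 5, 13]} : Set (Fin 5 → ℕ∞)),
      E.HasCyclicStar κ := by
  obtain ⟨q, hq, h⟩ := E.exists_hasCyclicStar hG
  refine ⟨q.bounds, ?_, h⟩
  have hmem := List.mem_map_of_mem (f := Five.bounds) hq
  simpa [starTypes, Five.bounds, uncut] using hmem
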